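/- **Conventions.** "Functor" between bicategories means pseudofunctor (strong functor). $\mathbf{CAT}(\mathbf X,\mathbf D)$ denotes the category of functors $\mathbf X\to\mathbf D$ and natural transformations; if $\mathbf D$ is symmetric monoidal it carries the pointwise symmetric monoidal structure, and pointwise sums $F\oplus G$ of monoidal functors $F,G:\mathbf X\to\mathbf D$ are monoidal through the interchange $(Fx\oplus Gx)\oplus(Fy\oplus Gy)\cong(Fx\oplus Fy)\oplus(Gx\oplus Gy)$; the constant functor $\mathbf 0$ is monoidal through $\mathbf 0\oplus\mathbf 0\cong\mathbf 0$. An **SMC-category** is a bicategory $\mathbf C$ with a symmetric monoidal structure $(\oplus,\mathbf 0)$ on every category $\mathbf C(a,b)$ and with symmetric strong monoidal structures on the functors $$\mathbf C(b,c)\to\mathbf{CAT}(\mathbf C(a,b),\mathbf C(a,c)),\ g\mapsto g\circ-,\qquad \mathbf C(a,b)\to\mathbf{CAT}(\mathbf C(b,c),\mathbf C(a,c)),\ f\mapsto -\circ f,$$ such that, when each $g\circ -$ is regarded as a monoidal functor through the structure maps of the second functor and each $-\circ f$ through those of the first, 1. the isomorphisms $(f\oplus g)\circ-\cong(f\circ-)\oplus(g\circ-)$,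 $-\circ(f\oplus g)\cong(-\circ f)\oplus(-\circ g)$, $\mathbf 0\circ-\cong\mathbf 0$ and $-\circ\mathbf 0\cong\mathbf 0$ are isomorphisms of monoidal functors; 2. the isomorphisms $f\circ(g\circ-)\cong(f\circ g)\circ-$, $(-\circ f)\circ g\cong-\circ(f\circ g)$, $f\circ(-\circ g)\cong(f\circ-)\circ g$, $-\circ\mathbf 1\cong\mathrm{id}$ and $\mathbf 1\circ-\cong\mathrm{id}$ of the bicategory are isomorphisms of monoidal functors. A **PC-category** is an SMC-category whose bicategory is a (strict) $2$-category, in which every $\mathbf C(a,b)$ is permutative (the associativity and unit isomorphisms of $\oplus$ are identities), the monoidal structure on $g\mapsto g\circ-$ is strict, and the monoidal structure on $f\mapsto-\circ f$ is strictly unital. **Proposition 7.1.** Let $\mathbf B$ be a bicategory and $\mathbf C$ an SMC-category. Then the bicategory $\mathbf{Bicat}(\mathbf B,\mathbf C)$ of pseudofunctors, strong transformations and modifications is an SMC-category, with the following pointwise structure. For strong transformations $\eta,\sigma:F\Rightarrow G$, the sum has the components $(\eta\oplus\sigma)_b=\eta_b\oplus\sigma_b$, and for $f:b\to c$ its naturality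 isomorphism $(\eta\oplus\sigma)_f$ is the composite $$Gf\circ(\eta_b\oplus\sigma_b)\cong (Gf\circ\eta_b)\oplus(Gf\circ\sigma_b)\xrightarrow{\ \eta_f\oplus\sigma_f\ }(\eta_c\circ Ff)\oplus(\sigma_c\circ Ff)\cong(\eta_c\oplus\sigma_c)\circ Ff;$$ the zero transformation has the components $\mathbf 0$ and the naturality isomorphisms $Gf\circ\mathbf 0\cong\mathbf 0\cong\mathbf 0\circ Ff$; sums of modifications, the associativity, unit and symmetry isomorphisms of $\oplus$, and the structure isomorphisms of $g\mapsto g\circ-$ and $f\mapsto-\circ f$ are, at every $0$-cell $b$ of $\mathbf B$, those of $\mathbf C$. If $\mathbf C$ is moreover a PC-category, then $\mathbf{Bicat}(\mathbf B,\mathbf C)$ with this structure is a PC-category. -/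

import Mathlib

open CategoryTheory MonoidalCategory
open CategoryTheory.Bicategory (precomposing postcomposing associatorNatIsoLeft
  associatorNatIsoMiddle associatorNatIsoRight leftUnitorNatIso rightUnitorNatIso)
open CategoryTheory.Functor.LaxMonoidal
open scoped CategoryTheory.Pseudofunctor.StrongTrans

universe w₁ w₂ v₁ v₂ u₁ u₂

/-! ### Monoidal structures on constant functors and on pointwise sums of functors

The functor category `X ⥤ D` carries Mathlib's pointwise (symmetric) monoidal structure. -/

section FunctorSums

variable {X : Type u₁} [Category.{v₁} X] [MonoidalCategory X]
  {D : Type u₂} [Category.{v₂} D] [MonoidalCategory D]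

/-- The unit of the pointwise monoidal structure on `X ⥤ D`, i.e. the constant functor at the unit
object of `D`, as a monoidal functor. -/
instance unitFunctorLaxMonoidal : (𝟙_ (X ⥤ D)).LaxMonoidal where
  ε := 𝟙 (𝟙_ D)
  μ _ _ := (λ_ (𝟙_ D)).hom
  left_unitality x := by simp
  right_unitality x := by simp [unitors_equal]
  associativity x y z := by simp [unitors_equal]

/-- The pointwise tensor product `F ⊗ G` of two monoidal functors into a symmetric monoidal
category, as a monoidal functor. Its structure map is
`(F x ⊗ G x) ⊗ (F y ⊗ G y) ≅ (F x ⊗ F y) ⊗ (G x ⊗ G y) ⟶ F (x ⊗ y) ⊗ G (x ⊗ y)`,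
where the first map is the middle-four interchange. -/
instance tensorFunctorLaxMonoidal [SymmetricCategory D] (F G : X ⥤ D)
    [F.LaxMonoidal] [G.LaxMonoidal] : (F ⊗ G).LaxMonoidal where
  ε := (λ_ (𝟙_ D)).inv ≫ (ε F ⊗ₘ ε G)
  μ x y := tensorμ (F.obj x) (G.obj x) (F.obj y) (G.obj y) ≫ (μ F x y ⊗ₘ μ G x y)
  μ_natural_left f x' := by
    simpa using μ_natural_left (F.prod' G ⋙ tensor D) f x'
  μ_natural_right x' f := by
    simpa using μ_natural_right (F.prod' G ⋙ tensor D) x' f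
  associativity x y z := by
    simpa using associativity (F.prod' G ⋙ tensor D) x y z
  left_unitality x := by
    simpa using left_unitality (F.prod' G ⋙ tensor D) x
  right_unitality x := by
    simpa using right_unitality (F.prod' G ⋙ tensor D) x

end FunctorSums

/-! ### SMC-categories -/

/-- The data of an SMC-category on a bicategory `B`: a symmetric monoidal structure (the "sum") on
every category `a ⟶ b`, and symmetric strong monoidal structures on the two functors adjoint to
composition. Composition is written diagrammatically: `f ≫ g` is `g ∘ f`. -/
class SMCData (B : Type u₁) [Bicategory.{w₁, v₁} B] where
  /-- The monoidal structure on `B(a, b)`. -/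
  homMonoidal (a b : B) : MonoidalCategory (a ⟶ b)
  /-- The symmetry of the monoidal structure on `B(a, b)`. -/
  homSymmetric (a b : B) : SymmetricCategory (a ⟶ b)
  /-- The functor `B(b, c) ⥤ CAT(B(a, b), B(a, c))`, `g ↦ g ∘ -`, is symmetric strong monoidal. -/
  postcomposingBraided (a b c : B) : (postcomposing a b c).Braided
  /-- The functor `B(a, b) ⥤ CAT(B(b, c), B(a, c))`, `f ↦ - ∘ f`, is symmetric strong monoidal. -/
  precomposingBraided (a b c : B) : (precomposing a b c).Braided

attribute [reducible, instance] SMCData.homMonoidal SMCData.homSymmetric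
  SMCData.postcomposingBraided SMCData.precomposingBraided

section SMC

variable {B : Type u₁} [Bicategory.{w₁, v₁} B] [SMCData B]

/-- For a 1-cell `g : b ⟶ c`, the functor `g ∘ - : B(a, b) ⥤ B(a, c)` is monoidal: the structure
maps `(g ∘ f) ⊗ (g ∘ f') ⟶ g ∘ (f ⊗ f')` and `𝟙_ ⟶ g ∘ 𝟙_` are the components at `g` of the
structure maps of the functor `f ↦ - ∘ f`. -/
instance postcompLaxMonoidal (a : B) {b c : B} (g : b ⟶ c) :
    ((postcomposing a b c).obj g).LaxMonoidal where
  ε := (ε (precomposing a b c)).app g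
  μ f f' := (μ (precomposing a b c) f f').app g
  μ_natural_left θ f := congr_app (μ_natural_left (precomposing a b c) θ f) g
  μ_natural_right f θ := congr_app (μ_natural_right (precomposing a b c) f θ) g
  associativity f f' f'' := congr_app (associativity (precomposing a b c) f f' f'') g
  left_unitality f := congr_app (left_unitality (precomposing a b c) f) g
  right_unitality f := congr_app (right_unitality (precomposing a b c) f) g

/-- For a 1-cell `f : a ⟶ b`, the functor `- ∘ f : B(b, c) ⥤ B(a, c)` is monoidal: the structure
maps `(g ∘ f) ⊗ (g' ∘ f) ⟶ (g ⊗ g') ∘ f` and `𝟙_ ⟶ 𝟙_ ∘ f` are the components at `f` of the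
structure maps of the functor `g ↦ g ∘ -`. -/
instance precompLaxMonoidal {a b : B} (c : B) (f : a ⟶ b) :
    ((precomposing a b c).obj f).LaxMonoidal where
  ε := (ε (postcomposing a b c)).app f
  μ g g' := (μ (postcomposing a b c) g g').app f
  μ_natural_left θ g := congr_app (μ_natural_left (postcomposing a b c) θ g) f
  μ_natural_right g θ := congr_app (μ_natural_right (postcomposing a b c) g θ) f
  associativity g g' g'' := congr_app (associativity (postcomposing a b c) g g' g'') f
  left_unitality g := congr_app (left_unitality (postcomposing a b c) g) f
  right_unitality g := congr_app (right_unitality (postcomposing a b c) g) f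

end SMC

/-- An SMC-category structure on a bicategory `B`. -/
class SMCCategory (B : Type u₁) [Bicategory.{w₁, v₁} B] extends SMCData B where
  /-- `(g ∘ -) ⊗ (g' ∘ -) ≅ (g ⊗ g') ∘ -` is an isomorphism of monoidal functors. -/
  postcomposing_μ_isMonoidal {a b c : B} (g g' : b ⟶ c) :
    NatTrans.IsMonoidal (μ (postcomposing a b c) g g')
  /-- `(- ∘ f) ⊗ (- ∘ f') ≅ - ∘ (f ⊗ f')` is an isomorphism of monoidal functors. -/
  precomposing_μ_isMonoidal {a b c : B} (f f' : a ⟶ b) :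
    NatTrans.IsMonoidal (μ (precomposing a b c) f f')
  /-- `𝟙_ ≅ 𝟙_ ∘ -` is an isomorphism of monoidal functors. -/
  postcomposing_ε_isMonoidal (a b c : B) :
    NatTrans.IsMonoidal (ε (postcomposing a b c))
  /-- `𝟙_ ≅ - ∘ 𝟙_` is an isomorphism of monoidal functors. -/
  precomposing_ε_isMonoidal (a b c : B) :
    NatTrans.IsMonoidal (ε (precomposing a b c))
  /-- `h ∘ (g ∘ -) ≅ (h ∘ g) ∘ -` is an isomorphism of monoidal functors. -/
  associatorLeft_isMonoidal (a : B) {b c d : B} (g : b ⟶ c) (h : c ⟶ d) :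
    NatTrans.IsMonoidal (associatorNatIsoLeft a g h).hom
  /-- `h ∘ (- ∘ f) ≅ (h ∘ -) ∘ f` is an isomorphism of monoidal functors. -/
  associatorMiddle_isMonoidal {a b c d : B} (f : a ⟶ b) (h : c ⟶ d) :
    NatTrans.IsMonoidal (associatorNatIsoMiddle f h).hom
  /-- `- ∘ (g ∘ f) ≅ (- ∘ g) ∘ f` is an isomorphism of monoidal functors. -/
  associatorRight_isMonoidal {a b c : B} (f : a ⟶ b) (g : b ⟶ c) (d : B) :
    NatTrans.IsMonoidal (associatorNatIsoRight f g d).hom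
  /-- `- ∘ 𝟙 a ≅ id` is an isomorphism of monoidal functors. -/
  leftUnitor_isMonoidal (a b : B) : NatTrans.IsMonoidal (leftUnitorNatIso a b).hom
  /-- `𝟙 b ∘ - ≅ id` is an isomorphism of monoidal functors. -/
  rightUnitor_isMonoidal (a b : B) : NatTrans.IsMonoidal (rightUnitorNatIso a b).hom

/-! ### PC-categories -/

/-- A monoidal category is strict if its associators and unitors are identities. A strict symmetric
monoidal category is a permutative category. -/
class IsStrictMonoidalCategory (D : Type u₁) [Category.{v₁} D] [MonoidalCategory D] : Prop where
  tensor_assoc (x y z : D) : (x ⊗ y) ⊗ z = x ⊗ (y ⊗ z)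
  unit_tensor (x : D) : 𝟙_ D ⊗ x = x
  tensor_unit (x : D) : x ⊗ 𝟙_ D = x
  associator_eqToIso (x y z : D) : α_ x y z = eqToIso (tensor_assoc x y z)
  leftUnitor_eqToIso (x : D) : λ_ x = eqToIso (unit_tensor x)
  rightUnitor_eqToIso (x : D) : ρ_ x = eqToIso (tensor_unit x)

section StrictFunctors

variable {X : Type u₁} [Category.{v₁} X] [MonoidalCategory X]
  {D : Type u₂} [Category.{v₂} D] [MonoidalCategory D]

/-- A monoidal functor is strictly unital if its unit constraint is an identity. -/
class IsStrictlyUnital (F : X ⥤ D) [F.LaxMonoidal] : Prop where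
  unit_eq : 𝟙_ D = F.obj (𝟙_ X)
  ε_eqToHom : ε F = eqToHom unit_eq

/-- A monoidal functor is strict if its unit and tensor constraints are identities. -/
class IsStrictMonoidalFunctor (F : X ⥤ D) [F.LaxMonoidal] : Prop extends IsStrictlyUnital F where
  tensor_eq (x y : X) : F.obj x ⊗ F.obj y = F.obj (x ⊗ y)
  μ_eqToHom (x y : X) : μ F x y = eqToHom (tensor_eq x y)

end StrictFunctors

/-- An SMC-category is a PC-category if the bicategory is a 2-category, every `C(c, d)` is a
permutative category, `g ↦ g ∘ -` is strict monoidal and `f ↦ - ∘ f` is strictly unital. -/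
class IsPCCategory (C : Type u₁) [Bicategory.{w₁, v₁} C] [SMCCategory C] : Prop where
  strict : Bicategory.Strict C
  hom_strict (c d : C) : IsStrictMonoidalCategory (c ⟶ d)
  postcomposing_strict (a b c : C) : IsStrictMonoidalFunctor (postcomposing a b c)
  precomposing_unital (a b c : C) : IsStrictlyUnital (precomposing a b c)

/-! ### Pointwise structures on bicategories of pseudofunctors -/

section Pointwise

variable {B : Type u₁} [Bicategory.{w₁, v₁} B] {C : Type u₂} [Bicategory.{w₂, v₂} C]
  [SMCData C] {F G : Pseudofunctor B C}

/-- The naturality constraint of a pointwise sum `η ⊕ σ` of strong transformations at a 1-cell `f`: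
`(η_c ⊕ σ_c) ∘ Ff ≅ (η_c ∘ Ff) ⊕ (σ_c ∘ Ff) ≅ (Gf ∘ η_b) ⊕ (Gf ∘ σ_b) ≅ Gf ∘ (η_b ⊕ σ_b)`. -/
def sumNaturality (η σ : F ⟶ G) {b c : B} (f : b ⟶ c) :
    F.map f ≫ (η.app c ⊗ σ.app c) ⟶ (η.app b ⊗ σ.app b) ≫ G.map f :=
  (Functor.OplaxMonoidal.δ (postcomposing _ _ _) (η.app c) (σ.app c)).app (F.map f) ≫
    ((η.naturality f).hom ⊗ₘ (σ.naturality f).hom) ≫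
    (μ (precomposing _ _ _) (η.app b) (σ.app b)).app (G.map f)

variable (F G) in
/-- The naturality constraint of the pointwise zero transformation at a 1-cell `f`:
`0 ∘ Ff ≅ 0 ≅ Gf ∘ 0`. -/
def zeroNaturality {b c : B} (f : b ⟶ c) :
    F.map f ≫ 𝟙_ (F.obj c ⟶ G.obj c) ⟶ 𝟙_ (F.obj b ⟶ G.obj b) ≫ G.map f :=
  (Functor.OplaxMonoidal.η (postcomposing _ _ _)).app (F.map f) ≫
    (ε (precomposing _ _ _)).app (G.map f)

end Pointwise

/-- The SMC-structure on the bicategory of pseudofunctors `Pseudofunctor B C` (with strong transformations and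
modifications) is the pointwise one: the sum and zero of strong transformations, the sum of
modifications and all constraint isomorphisms are obtained from those of `C` at every object `b` of
`B`. The endpoints of the 2-cells that are compared by `HEq` are equal by `sum_app` and
`zero_app`. -/
structure IsPointwiseSMC (B : Type u₁) [Bicategory.{w₁, v₁} B] (C : Type u₂)
    [Bicategory.{w₂, v₂} C] [SMCData C] [SMCData (Pseudofunctor B C)] : Prop where
  sum_app {F G : Pseudofunctor B C} (η σ : F ⟶ G) (b : B) : (η ⊗ σ).app b = η.app b ⊗ σ.app b
  sum_naturality {F G : Pseudofunctor B C} (η σ : F ⟶ G) {b c : B} (f : b ⟶ c) :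
    ((η ⊗ σ).naturality f).hom ≍ sumNaturality η σ f
  zero_app (F G : Pseudofunctor B C) (b : B) : (𝟙_ (F ⟶ G)).app b = 𝟙_ (F.obj b ⟶ G.obj b)
  zero_naturality (F G : Pseudofunctor B C) {b c : B} (f : b ⟶ c) :
    ((𝟙_ (F ⟶ G)).naturality f).hom ≍ zeroNaturality F G f
  sum_modification {F G : Pseudofunctor B C} {η η' σ σ' : F ⟶ G} (Γ : η ⟶ η') (Δ : σ ⟶ σ') (b : B) :
    (Γ ⊗ₘ Δ).as.app b ≍ Γ.as.app b ⊗ₘ Δ.as.app b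
  associator_app {F G : Pseudofunctor B C} (η σ τ : F ⟶ G) (b : B) :
    (α_ η σ τ).hom.as.app b ≍ (α_ (η.app b) (σ.app b) (τ.app b)).hom
  leftUnitor_app {F G : Pseudofunctor B C} (η : F ⟶ G) (b : B) :
    (λ_ η).hom.as.app b ≍ (λ_ (η.app b)).hom
  rightUnitor_app {F G : Pseudofunctor B C} (η : F ⟶ G) (b : B) :
    (ρ_ η).hom.as.app b ≍ (ρ_ (η.app b)).hom
  braiding_app {F G : Pseudofunctor B C} (η σ : F ⟶ G) (b : B) :
    (β_ η σ).hom.as.app b ≍ (β_ (η.app b) (σ.app b)).hom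
  postcomposing_μ_app {F G H : Pseudofunctor B C} (η : F ⟶ G) (σ τ : G ⟶ H) (b : B) :
    ((μ (postcomposing F G H) σ τ).app η).as.app b ≍
      (μ (postcomposing _ _ _) (σ.app b) (τ.app b)).app (η.app b)
  postcomposing_ε_app {F G : Pseudofunctor B C} (η : F ⟶ G) (H : Pseudofunctor B C) (b : B) :
    ((ε (postcomposing F G H)).app η).as.app b ≍
      (ε (postcomposing _ _ (H.obj b))).app (η.app b)
  precomposing_μ_app {F G H : Pseudofunctor B C} (η σ : F ⟶ G) (τ : G ⟶ H) (b : B) :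
    ((μ (precomposing F G H) η σ).app τ).as.app b ≍
      (μ (precomposing _ _ _) (η.app b) (σ.app b)).app (τ.app b)
  precomposing_ε_app (F : Pseudofunctor B C) {G H : Pseudofunctor B C} (τ : G ⟶ H) (b : B) :
    ((ε (precomposing F G H)).app τ).as.app b ≍
      (ε (precomposing (F.obj b) _ _)).app (τ.app b)

/-! ### Morphisms compatible with sums -/

section Additive

variable {D : Type u₁} [Category.{v₁} D] [MonoidalCategory D]

/-! The difficulty lies in showing that the pointwise sums and zeros are strong transformations and
that the proposed structure 2-cells are modifications. Call a 2-cell `U` the sum of `u` and `u'`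
along comparison maps `m`, `n` when `m ≫ U = (u ⊗ₘ u') ≫ n`. Such squares paste (`IsSumOf.comp`),
and `U` is determined by `u` and `u'` once `m` is epi (`IsSumOf.eq`). In an SMC-category whiskerings
are sums by naturality of the distributors, and associators and unitors are sums by condition 2.
Hence an equation between pastings of such cells that holds for `η` and for `σ` holds for `η ⊕ σ`.
Zero is the nullary case, with `zeroLeft` and `zeroRight` as comparison maps.

The associator, unitors and symmetry are modifications because `Ff ≫ -` and `- ≫ Gf` are monoidal
and a naturality constraint is a map from a value of the first to a value of the second; sums of
such maps respect coherence isomorphisms. The distributors are modifications because the constraint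
of a composite transformation is a pasting of sums. Every remaining axiom is an equation of
modifications, and its component at `b` is the same axiom in `C`.

For PC-categories, a modification whose components are all `eqToHom` is itself an `eqToHom`
(`exists_eq_eqToHom_of_as_app`), so strictness is also checked pointwise. -/

/-- `U` is the sum of `u` and `u'` with respect to comparison maps `m` and `n`. -/
def IsSumOf {p p' P q q' Q : D} (m : p ⊗ p' ⟶ P) (n : q ⊗ q' ⟶ Q)
    (u : p ⟶ q) (u' : p' ⟶ q') (U : P ⟶ Q) : Prop :=
  m ≫ U = (u ⊗ₘ u') ≫ n

namespace IsSumOf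

variable {p p' P q q' Q r r' R : D} {m : p ⊗ p' ⟶ P} {n : q ⊗ q' ⟶ Q} {k : r ⊗ r' ⟶ R}
  {u : p ⟶ q} {u' : p' ⟶ q'} {U : P ⟶ Q} {v : q ⟶ r} {v' : q' ⟶ r'} {V : Q ⟶ R}

theorem comp (h : IsSumOf m n u u' U) (h' : IsSumOf n k v v' V) :
    IsSumOf m k (u ≫ v) (u' ≫ v') (U ≫ V) := by
  unfold IsSumOf at *
  rw [← tensorHom_comp_tensorHom, Category.assoc, ← h', ← Category.assoc, h, Category.assoc]

/-- This uniqueness converts equations between summands into equations between sums. -/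
theorem eq [Epi m] {V : P ⟶ Q} (h : IsSumOf m n u u' U) (h' : IsSumOf m n u u' V) : U = V := by
  unfold IsSumOf at *
  rw [← cancel_epi m, h, h']

theorem inv {e : p ≅ q} {e' : p' ≅ q'} {E : P ≅ Q} (h : IsSumOf m n e.hom e'.hom E.hom) :
    IsSumOf n m e.inv e'.inv E.inv := by
  unfold IsSumOf at *
  rw [Iso.comp_inv_eq, Category.assoc, h, tensorHom_comp_tensorHom_assoc]
  simp

theorem of_conj {i : P ⟶ p ⊗ p'} (h : m ≫ i = 𝟙 _) :
    IsSumOf m n u u' (i ≫ (u ⊗ₘ u') ≫ n) := by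
  unfold IsSumOf
  rw [← Category.assoc, h, Category.id_comp]

/-- Used when `X` is a sum along two-step comparisons: stripping the first steps `m`, `n` leaves the
square that makes the second steps `g`, `h` the components of a modification. -/
theorem comp_eq {P' Q' : D} {m : p ⊗ p' ⟶ P} {g : P ⟶ P'} {n : q ⊗ q' ⟶ Q}
    {h : Q ⟶ Q'} {u : p ⟶ q} {u' : p' ⟶ q'} {X : P' ⟶ Q'} {S : P ⟶ Q} [Epi m]
    (hX : IsSumOf (m ≫ g) (n ≫ h) u u' X) (hS : IsSumOf m n u u' S) : g ≫ X = S ≫ h := by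
  unfold IsSumOf at *
  rw [← cancel_epi m, ← Category.assoc, hX, reassoc_of% hS]

end IsSumOf

/-! ### Sums of maps between the values of two monoidal functors. -/

section Coherence

variable {M : Type u₁} [Category.{v₁} M] [MonoidalCategory M]
  {N : Type u₂} [Category.{v₂} N] [MonoidalCategory N]
  {P : Type w₁} [Category.{w₂} P] [MonoidalCategory P]
  (L : M ⥤ P) (R : N ⥤ P) [L.LaxMonoidal] [R.LaxMonoidal]
  {x y z : M} {x' y' z' : N} {a : L.obj x ⟶ R.obj x'} {b : L.obj y ⟶ R.obj y'}
  {c : L.obj z ⟶ R.obj z'}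

/-- Triples `(x, x', a : L x ⟶ R x')` form the comma category of `L` and `R`, and `IsSumOf`
describes its tensor product. The associators of `M` and `N` form a morphism there: cancel the
structure maps of `L`, then use associativity of `L` and `R` and naturality of the associator of
`P`. In the application `L` is `Ff ≫ -` and `R` is `- ≫ Gf`. -/
theorem IsSumOf.associator {ab : L.obj (x ⊗ y) ⟶ R.obj (x' ⊗ y')}
    {bc : L.obj (y ⊗ z) ⟶ R.obj (y' ⊗ z')}
    {abc₁ : L.obj ((x ⊗ y) ⊗ z) ⟶ R.obj ((x' ⊗ y') ⊗ z')}
    {abc₂ : L.obj (x ⊗ y ⊗ z) ⟶ R.obj (x' ⊗ y' ⊗ z')} [IsIso (μ L x y)] [IsIso (μ L (x ⊗ y) z)]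
    (hab : IsSumOf (μ L _ _) (μ R _ _) a b ab) (hbc : IsSumOf (μ L _ _) (μ R _ _) b c bc)
    (h₁ : IsSumOf (μ L _ _) (μ R _ _) ab c abc₁) (h₂ : IsSumOf (μ L _ _) (μ R _ _) a bc abc₂) :
    L.map (α_ x y z).hom ≫ abc₂ = abc₁ ≫ R.map (α_ x' y' z').hom := by
  unfold IsSumOf at *
  rw [← cancel_epi (μ L (x ⊗ y) z), ← cancel_epi (μ L x y ▷ L.obj z), reassoc_of% h₁,
    associativity_assoc, h₂]
  have e : μ L x y ▷ L.obj z ≫ (ab ⊗ₘ c) = ((a ⊗ₘ b) ⊗ₘ c) ≫ μ R x' y' ▷ R.obj z' := by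
    rw [← tensorHom_id, ← tensorHom_id, tensorHom_comp_tensorHom, tensorHom_comp_tensorHom, hab]
    simp
  have e' : L.obj x ◁ μ L y z ≫ (a ⊗ₘ bc) = (a ⊗ₘ (b ⊗ₘ c)) ≫ R.obj x' ◁ μ R y' z' := by
    rw [← id_tensorHom, ← id_tensorHom, tensorHom_comp_tensorHom, tensorHom_comp_tensorHom, hbc]
    simp
  rw [reassoc_of% e, reassoc_of% e', associativity, associator_naturality_assoc]

theorem IsSumOf.leftUnitor {o : L.obj (𝟙_ M) ⟶ R.obj (𝟙_ N)}
    {oa : L.obj (𝟙_ M ⊗ x) ⟶ R.obj (𝟙_ N ⊗ x')} [IsIso (μ L (𝟙_ M) x)] [IsIso (ε L)]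
    (ho : ε L ≫ o = ε R) (h : IsSumOf (μ L _ _) (μ R _ _) o a oa) :
    L.map (λ_ x).hom ≫ a = oa ≫ R.map (λ_ x').hom := by
  unfold IsSumOf at *
  rw [← cancel_epi (μ L (𝟙_ M) x), ← cancel_epi (ε L ▷ L.obj x), reassoc_of% h,
    ← left_unitality_assoc, ← tensorHom_id, tensorHom_comp_tensorHom_assoc, ho, Category.id_comp,
    ← leftUnitor_naturality, left_unitality R, ← Category.assoc (𝟙_ P ◁ a), ← id_tensorHom,
    ← tensorHom_id, tensorHom_comp_tensorHom]
  simp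

theorem IsSumOf.rightUnitor {o : L.obj (𝟙_ M) ⟶ R.obj (𝟙_ N)}
    {ao : L.obj (x ⊗ 𝟙_ M) ⟶ R.obj (x' ⊗ 𝟙_ N)} [IsIso (μ L x (𝟙_ M))] [IsIso (ε L)]
    (ho : ε L ≫ o = ε R) (h : IsSumOf (μ L _ _) (μ R _ _) a o ao) :
    L.map (ρ_ x).hom ≫ a = ao ≫ R.map (ρ_ x').hom := by
  unfold IsSumOf at *
  rw [← cancel_epi (μ L x (𝟙_ M)), ← cancel_epi (L.obj x ◁ ε L), reassoc_of% h,
    ← right_unitality_assoc, ← id_tensorHom, tensorHom_comp_tensorHom_assoc, ho, Category.id_comp,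
    ← rightUnitor_naturality, right_unitality R, ← Category.assoc (a ▷ 𝟙_ P), ← id_tensorHom,
    ← tensorHom_id, tensorHom_comp_tensorHom]
  simp

/-- Compatibility with braidings is assumed only at the objects involved; `distribLeft_braiding` and
`distribRight_braiding` supply it. -/
theorem IsSumOf.braiding [BraidedCategory M] [BraidedCategory N] [BraidedCategory P]
    (hL : μ L x y ≫ L.map (β_ x y).hom = (β_ (L.obj x) (L.obj y)).hom ≫ μ L y x)
    (hR : μ R x' y' ≫ R.map (β_ x' y').hom = (β_ (R.obj x') (R.obj y')).hom ≫ μ R y' x')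
    {ab : L.obj (x ⊗ y) ⟶ R.obj (x' ⊗ y')} {ba : L.obj (y ⊗ x) ⟶ R.obj (y' ⊗ x')}
    [IsIso (μ L x y)]
    (hab : IsSumOf (μ L _ _) (μ R _ _) a b ab) (hba : IsSumOf (μ L _ _) (μ R _ _) b a ba) :
    L.map (β_ x y).hom ≫ ba = ab ≫ R.map (β_ x' y').hom := by
  unfold IsSumOf at *
  rw [← cancel_epi (μ L x y), reassoc_of% hL, hba, reassoc_of% hab, hR]
  simp

end Coherence

end Additive

/-! ### Distributivity of composition over sums -/

local infixr:81 " ◃ " => Bicategory.whiskerLeft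
local infixl:81 " ▹ " => Bicategory.whiskerRight
local notation "𝔞" => Bicategory.associator
local notation "𝔩" => Bicategory.leftUnitor
local notation "𝔯" => Bicategory.rightUnitor

section Distributors

variable {C : Type u₂} [Bicategory.{w₂, v₂} C] [SMCData C] {a b c d : C}

/-- Precomposition with a 1-cell distributes over sums. -/
abbrev distribLeft (f : a ⟶ b) (x y : b ⟶ c) : (f ≫ x) ⊗ (f ≫ y) ≅ f ≫ (x ⊗ y) :=
  (Functor.Monoidal.μIso (postcomposing a b c) x y).app f

/-- Postcomposition with a 1-cell distributes over sums. -/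
abbrev distribRight (x y : a ⟶ b) (g : b ⟶ c) : (x ≫ g) ⊗ (y ≫ g) ≅ (x ⊗ y) ≫ g :=
  (Functor.Monoidal.μIso (precomposing a b c) x y).app g

/-- Precomposition with a 1-cell preserves zero. -/
abbrev zeroLeft (c : C) (f : a ⟶ b) : 𝟙_ (a ⟶ c) ≅ f ≫ 𝟙_ (b ⟶ c) :=
  (Functor.Monoidal.εIso (postcomposing a b c)).app f

/-- Postcomposition with a 1-cell preserves zero. -/
abbrev zeroRight (a : C) (g : b ⟶ c) : 𝟙_ (a ⟶ c) ≅ 𝟙_ (a ⟶ b) ≫ g :=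
  (Functor.Monoidal.εIso (precomposing a b c)).app g

/-- A distributor is natural in each of its three arguments. Naturality in the two summands comes
from the structure map of the adjoint functor being natural, naturality in the common factor from
each of its values being a natural transformation. -/
theorem isSumOf_whiskerLeft_tensorHom (f : a ⟶ b) {x x' y y' : b ⟶ c} (s : x ⟶ x') (t : y ⟶ y') :
    IsSumOf (distribLeft f x y).hom (distribLeft f x' y').hom (f ◃ s) (f ◃ t) (f ◃ (s ⊗ₘ t)) :=
  (μ_natural ((precomposing a b c).obj f) s t).symm

theorem isSumOf_tensorHom_whiskerRight {x x' y y' : a ⟶ b} (s : x ⟶ x') (t : y ⟶ y') (g : b ⟶ c) :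
    IsSumOf (distribRight x y g).hom (distribRight x' y' g).hom (s ▹ g) (t ▹ g) ((s ⊗ₘ t) ▹ g) :=
  (μ_natural ((postcomposing a b c).obj g) s t).symm

theorem isSumOf_whiskerRight {f f' : a ⟶ b} (s : f ⟶ f') (x y : b ⟶ c) :
    IsSumOf (distribLeft f x y).hom (distribLeft f' x y).hom (s ▹ x) (s ▹ y) (s ▹ (x ⊗ y)) :=
  ((μ (postcomposing a b c) x y).naturality s).symm

theorem isSumOf_whiskerLeft (x y : a ⟶ b) {g g' : b ⟶ c} (s : g ⟶ g') :
    IsSumOf (distribRight x y g).hom (distribRight x y g').hom (x ◃ s) (y ◃ s) ((x ⊗ y) ◃ s) :=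
  ((μ (precomposing a b c) x y).naturality s).symm

theorem zeroLeft_naturality (c : C) {f f' : a ⟶ b} (s : f ⟶ f') :
    (zeroLeft c f).hom ≫ s ▹ 𝟙_ (b ⟶ c) = (zeroLeft c f').hom :=
  ((ε (postcomposing a b c)).naturality s).symm.trans (Category.id_comp _)

theorem zeroRight_naturality (a : C) {g g' : b ⟶ c} (s : g ⟶ g') :
    (zeroRight a g).hom ≫ 𝟙_ (a ⟶ b) ◃ s = (zeroRight a g').hom :=
  ((ε (precomposing a b c)).naturality s).symm.trans (Category.id_comp _)

/-- Whiskering adds one distributor to each comparison map; this is why `IsSumOf` allows arbitrary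
comparison maps. -/
theorem IsSumOf.whiskerLeft (f : a ⟶ b) {p p' P q q' Q : b ⟶ c} {m : p ⊗ p' ⟶ P} {n : q ⊗ q' ⟶ Q}
    {u : p ⟶ q} {u' : p' ⟶ q'} {U : P ⟶ Q} (h : IsSumOf m n u u' U) :
    IsSumOf ((distribLeft f p p').hom ≫ f ◃ m) ((distribLeft f q q').hom ≫ f ◃ n)
      (f ◃ u) (f ◃ u') (f ◃ U) := by
  have e := isSumOf_whiskerLeft_tensorHom f u u'
  unfold IsSumOf at *
  rw [Category.assoc, ← Bicategory.whiskerLeft_comp, h, Bicategory.whiskerLeft_comp, reassoc_of% e]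

theorem IsSumOf.whiskerRight (g : b ⟶ c) {p p' P q q' Q : a ⟶ b} {m : p ⊗ p' ⟶ P}
    {n : q ⊗ q' ⟶ Q} {u : p ⟶ q} {u' : p' ⟶ q'} {U : P ⟶ Q} (h : IsSumOf m n u u' U) :
    IsSumOf ((distribRight p p' g).hom ≫ m ▹ g) ((distribRight q q' g).hom ≫ n ▹ g)
      (u ▹ g) (u' ▹ g) (U ▹ g) := by
  have e := isSumOf_tensorHom_whiskerRight u u' g
  unfold IsSumOf at *
  rw [Category.assoc, ← Bicategory.comp_whiskerRight, h, Bicategory.comp_whiskerRight,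
    reassoc_of% e]

theorem distribLeft_braiding (f : a ⟶ b) (x y : b ⟶ c) :
    (distribLeft f x y).hom ≫ f ◃ (β_ x y).hom =
      (β_ (f ≫ x) (f ≫ y)).hom ≫ (distribLeft f y x).hom :=
  congr_app (Functor.LaxBraided.braided (F := postcomposing a b c) x y) f

theorem distribRight_braiding (x y : a ⟶ b) (g : b ⟶ c) :
    (distribRight x y g).hom ≫ (β_ x y).hom ▹ g =
      (β_ (x ≫ g) (y ≫ g)).hom ≫ (distribRight y x g).hom :=
  congr_app (Functor.LaxBraided.braided (F := precomposing a b c) x y) g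

end Distributors

/-! ### Compatibility of the distributors with associators and unitors. -/

section Associativity

variable {C : Type u₂} [Bicategory.{w₂, v₂} C] [SMCCategory C] {a b c d : C}

/-- This and the next four lemmas are the tensor halves of condition 2, with the structure map of a
composite functor unfolded into two distributors. The unit halves follow them. -/
theorem isSumOf_associator_left (x y : a ⟶ b) (g : b ⟶ c) (h : c ⟶ d) :
    IsSumOf ((distribRight (x ≫ g) (y ≫ g) h).hom ≫ (distribRight x y g).hom ▹ h)
      (distribRight x y (g ≫ h)).hom (𝔞 x g h).hom (𝔞 y g h).hom
      (𝔞 (x ⊗ y) g h).hom :=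
  (SMCCategory.associatorLeft_isMonoidal a g h).tensor x y

theorem isSumOf_associator_middle (f : a ⟶ b) (x y : b ⟶ c) (h : c ⟶ d) :
    IsSumOf ((distribRight (f ≫ x) (f ≫ y) h).hom ≫ (distribLeft f x y).hom ▹ h)
      ((distribLeft f (x ≫ h) (y ≫ h)).hom ≫ f ◃ (distribRight x y h).hom)
      (𝔞 f x h).hom (𝔞 f y h).hom (𝔞 f (x ⊗ y) h).hom :=
  (SMCCategory.associatorMiddle_isMonoidal f h).tensor x y

theorem isSumOf_associator_right (f : a ⟶ b) (g : b ⟶ c) (x y : c ⟶ d) :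
    IsSumOf (distribLeft (f ≫ g) x y).hom
      ((distribLeft f (g ≫ x) (g ≫ y)).hom ≫ f ◃ (distribLeft g x y).hom)
      (𝔞 f g x).hom (𝔞 f g y).hom (𝔞 f g (x ⊗ y)).hom :=
  (SMCCategory.associatorRight_isMonoidal f g d).tensor x y

theorem isSumOf_leftUnitor (x y : a ⟶ b) :
    IsSumOf (distribLeft (𝟙 a) x y).hom (𝟙 _) (𝔩 x).hom (𝔩 y).hom
      (𝔩 (x ⊗ y)).hom :=
  (SMCCategory.leftUnitor_isMonoidal a b).tensor x y

theorem isSumOf_rightUnitor (x y : a ⟶ b) :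
    IsSumOf (distribRight x y (𝟙 b)).hom (𝟙 _) (𝔯 x).hom (𝔯 y).hom
      (𝔯 (x ⊗ y)).hom :=
  (SMCCategory.rightUnitor_isMonoidal a b).tensor x y

theorem zeroRight_associator_left (a : C) (g : b ⟶ c) (h : c ⟶ d) :
    ((zeroRight a h).hom ≫ (zeroRight a g).hom ▹ h) ≫ (𝔞 (𝟙_ (a ⟶ b)) g h).hom =
      (zeroRight a (g ≫ h)).hom :=
  (SMCCategory.associatorLeft_isMonoidal a g h).unit

theorem zeroRight_associator_middle (f : a ⟶ b) (h : c ⟶ d) :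
    ((zeroRight a h).hom ≫ (zeroLeft c f).hom ▹ h) ≫ (𝔞 f (𝟙_ (b ⟶ c)) h).hom =
      (zeroLeft d f).hom ≫ f ◃ (zeroRight b h).hom :=
  (SMCCategory.associatorMiddle_isMonoidal f h).unit

theorem zeroLeft_associator_right (f : a ⟶ b) (g : b ⟶ c) (d : C) :
    (zeroLeft d (f ≫ g)).hom ≫ (𝔞 f g (𝟙_ (c ⟶ d))).hom =
      (zeroLeft d f).hom ≫ f ◃ (zeroLeft d g).hom :=
  (SMCCategory.associatorRight_isMonoidal f g d).unit

theorem zeroLeft_leftUnitor (a b : C) :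
    (zeroLeft b (𝟙 a)).hom ≫ (𝔩 (𝟙_ (a ⟶ b))).hom = 𝟙 _ :=
  (SMCCategory.leftUnitor_isMonoidal a b).unit

theorem zeroRight_rightUnitor (a b : C) :
    (zeroRight a (𝟙 b)).hom ≫ (𝔯 (𝟙_ (a ⟶ b))).hom = 𝟙 _ :=
  (SMCCategory.rightUnitor_isMonoidal a b).unit

end Associativity

/-! ### Sums of strong transformations -/

section SumTransformations

variable {B : Type u₁} [Bicategory.{w₁, v₁} B] {C : Type u₂} [Bicategory.{w₂, v₂} C]

section

variable [SMCData C] {F G : Pseudofunctor B C}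

/-- The form in which the constraint of a sum enters every later pasting argument. -/
theorem isSumOf_sumNaturality (η σ : F ⟶ G) {b c : B} (f : b ⟶ c) :
    IsSumOf (distribLeft (F.map f) (η.app c) (σ.app c)).hom
      (distribRight (η.app b) (σ.app b) (G.map f)).hom (η.naturality f).hom (σ.naturality f).hom
      (sumNaturality η σ f) :=
  IsSumOf.of_conj (distribLeft (F.map f) (η.app c) (σ.app c)).hom_inv_id

variable (F G) in
theorem zeroLeft_zeroNaturality {b c : B} (f : b ⟶ c) :
    (zeroLeft (G.obj c) (F.map f)).hom ≫ zeroNaturality F G f =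
      (zeroRight (F.obj b) (G.map f)).hom :=
  (zeroLeft (G.obj c) (F.map f)).hom_inv_id_assoc _

/-- The naturality isomorphism of a pointwise sum. -/
@[simps hom]
def sumNaturalityIso (η σ : F ⟶ G) {b c : B} (f : b ⟶ c) :
    F.map f ≫ (η.app c ⊗ σ.app c) ≅ (η.app b ⊗ σ.app b) ≫ G.map f where
  hom := sumNaturality η σ f
  inv := ((distribLeft _ _ _).symm ≪≫ (η.naturality f ⊗ᵢ σ.naturality f) ≪≫
    distribRight _ _ _).inv
  hom_inv_id := ((distribLeft _ _ _).symm ≪≫ (η.naturality f ⊗ᵢ σ.naturality f) ≪≫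
    distribRight _ _ _).hom_inv_id
  inv_hom_id := ((distribLeft _ _ _).symm ≪≫ (η.naturality f ⊗ᵢ σ.naturality f) ≪≫
    distribRight _ _ _).inv_hom_id

variable (F G) in
/-- The naturality isomorphism of the pointwise zero. -/
@[simps hom]
def zeroNaturalityIso {b c : B} (f : b ⟶ c) :
    F.map f ≫ 𝟙_ (F.obj c ⟶ G.obj c) ≅ 𝟙_ (F.obj b ⟶ G.obj b) ≫ G.map f where
  hom := zeroNaturality F G f
  inv := ((zeroLeft _ _).symm ≪≫ zeroRight _ _).inv
  hom_inv_id := ((zeroLeft _ (F.map f)).symm ≪≫ zeroRight _ (G.map f)).hom_inv_id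
  inv_hom_id := ((zeroLeft _ (F.map f)).symm ≪≫ zeroRight _ (G.map f)).inv_hom_id

end

variable [SMCCategory C] {F G : Pseudofunctor B C}

/-- The pointwise sum of two strong transformations. -/
abbrev sumTrans (η σ : F ⟶ G) : F ⟶ G where
  app b := η.app b ⊗ σ.app b
  naturality f := sumNaturalityIso η σ f
  naturality_naturality {b c f g} θ := by
    -- `l` and `r` present the two sides of the axiom as sums along the same comparison maps. The
    -- axiom for `η` and `σ` identifies the summands, and uniqueness concludes; the other two axioms
    -- go the same way.
    have l := (isSumOf_whiskerRight (F.map₂ θ) (η.app c) (σ.app c)).comp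
      (isSumOf_sumNaturality η σ g)
    have r := (isSumOf_sumNaturality η σ f).comp
      (isSumOf_whiskerLeft (η.app b) (σ.app b) (G.map₂ θ))
    rw [η.naturality_naturality, σ.naturality_naturality] at l
    exact l.eq r
  naturality_id b := by
    have l := (isSumOf_sumNaturality η σ (𝟙 b)).comp
      (isSumOf_whiskerLeft (η.app b) (σ.app b) (G.mapId b).hom)
    have r := ((isSumOf_whiskerRight (F.mapId b).hom (η.app b) (σ.app b)).comp
      (isSumOf_leftUnitor _ _)).comp (isSumOf_rightUnitor _ _).inv
    rw [η.naturality_id, σ.naturality_id] at l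
    simp only [Category.assoc] at r
    exact l.eq r
  naturality_comp {a b c} f g := by
    have l := (isSumOf_sumNaturality η σ (f ≫ g)).comp
      (isSumOf_whiskerLeft (η.app a) (σ.app a) (G.mapComp f g).hom)
    have r := (((((isSumOf_whiskerRight (F.mapComp f g).hom (η.app c) (σ.app c)).comp
      (isSumOf_associator_right _ _ _ _)).comp
      ((isSumOf_sumNaturality η σ g).whiskerLeft (F.map f))).comp
      (isSumOf_associator_middle _ _ _ _).inv).comp
      ((isSumOf_sumNaturality η σ f).whiskerRight (G.map g))).comp
      (isSumOf_associator_left _ _ _ _)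
    rw [η.naturality_comp, σ.naturality_comp] at l
    simp only [Category.assoc] at r
    exact l.eq r

variable (F G) in
/-- The pointwise zero transformation. -/
abbrev zeroTrans : F ⟶ G where
  app b := 𝟙_ (F.obj b ⟶ G.obj b)
  naturality f := zeroNaturalityIso F G f
  naturality_naturality {b c f g} θ := by
    -- In each axiom the source is an image of zero, so the isomorphism `zeroLeft` can be cancelled.
    -- Both sides then reduce to the same `zeroRight`.
    rw [← cancel_epi (zeroLeft _ _).hom, reassoc_of% zeroLeft_naturality]
    simp only [zeroNaturalityIso_hom]
    rw [zeroLeft_zeroNaturality, reassoc_of% zeroLeft_zeroNaturality, zeroRight_naturality]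
  naturality_id b := by
    rw [← cancel_epi (zeroLeft _ _).hom]
    simp only [zeroNaturalityIso_hom]
    rw [reassoc_of% zeroLeft_zeroNaturality, zeroRight_naturality, reassoc_of% zeroLeft_naturality,
      reassoc_of% zeroLeft_leftUnitor, ← cancel_mono (𝔯 _).hom, zeroRight_rightUnitor,
      Iso.inv_hom_id]
  naturality_comp {a b c} f g := by
    rw [← cancel_epi (zeroLeft _ _).hom]
    -- The composition axiom contains the inverse of the middle associator, so the compatibility is
    -- solved for that inverse.
    have m := (Iso.eq_comp_inv _).2
      (zeroRight_associator_middle (F.map f) (c := G.obj b) (G.map g))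
    have m' := zeroRight_associator_left (F.obj a) (G.map f) (G.map g)
    rw [Category.assoc] at m m'
    have u : F.map f ◃ (zeroLeft (G.obj c) (F.map g)).hom ≫ F.map f ◃ zeroNaturality F G g =
      F.map f ◃ (zeroRight _ (G.map g)).hom := by
      rw [← Bicategory.whiskerLeft_comp, zeroLeft_zeroNaturality]
    have v : (zeroLeft (G.obj b) (F.map f)).hom ▹ G.map g ≫ zeroNaturality F G f ▹ G.map g =
      (zeroRight _ (G.map f)).hom ▹ G.map g := by
      rw [← Bicategory.comp_whiskerRight, zeroLeft_zeroNaturality]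
    simp only [zeroNaturalityIso_hom]
    rw [reassoc_of% zeroLeft_zeroNaturality, zeroRight_naturality, reassoc_of% zeroLeft_naturality,
      reassoc_of% zeroLeft_associator_right, reassoc_of% u, ← reassoc_of% m, reassoc_of% v, m']

end SumTransformations

/-! ### The symmetric monoidal category of strong transformations -/

namespace PointwiseSum

open Pseudofunctor.StrongTrans (isoMk)

variable {B : Type u₁} [Bicategory.{w₁, v₁} B] {C : Type u₂} [Bicategory.{w₂, v₂} C]
  [SMCCategory C] {F G : Pseudofunctor B C}

/-- The pointwise sum of two modifications. -/
abbrev sumModification {η η' σ σ' : F ⟶ G} (Γ : η ⟶ η') (Δ : σ ⟶ σ') :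
    sumTrans η σ ⟶ sumTrans η' σ' where
  as :=
    { app b := Γ.as.app b ⊗ₘ Δ.as.app b
      naturality {b c} f := by
        have l := (isSumOf_whiskerLeft_tensorHom (F.map f) (Γ.as.app c) (Δ.as.app c)).comp
          (isSumOf_sumNaturality η' σ' f)
        have r := (isSumOf_sumNaturality η σ f).comp
          (isSumOf_tensorHom_whiskerRight (Γ.as.app b) (Δ.as.app b) (G.map f))
        rw [Γ.as.naturality, Δ.as.naturality] at l
        exact l.eq r }

/-- The instance on `f ≫ -` is only lax; the coherence lemmas for `IsSumOf` need its structure maps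
to be invertible. -/
instance isIso_μ_precomposing_obj {a b c : C} (f : a ⟶ b) (x y : b ⟶ c) :
    IsIso (μ ((precomposing a b c).obj f) x y) :=
  (distribLeft f x y).isIso_hom

instance isIso_ε_precomposing_obj {a b c : C} (f : a ⟶ b) :
    IsIso (ε ((precomposing a b c).obj f)) :=
  (zeroLeft c f).isIso_hom

/-- The data of the pointwise monoidal structure on strong transformations. -/
@[reducible]
def transMonoidalStruct (F G : Pseudofunctor B C) : MonoidalCategoryStruct (F ⟶ G) where
  tensorObj η σ := sumTrans η σ
  tensorUnit := zeroTrans F G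
  tensorHom Γ Δ := sumModification Γ Δ
  whiskerLeft η _ _ Δ :=
    { as :=
        { app b := η.app b ◁ Δ.as.app b
          naturality f := by
            -- The component is the whiskering of `C` itself, which keeps the later axioms
            -- definitional; its naturality is that of the sum with an identity.
            rw [← id_tensorHom, ← id_tensorHom]
            exact (sumModification (𝟙 η) Δ).as.naturality f } }
  whiskerRight Γ σ :=
    { as :=
        { app b := Γ.as.app b ▷ σ.app b
          naturality f := by
            rw [← tensorHom_id, ← tensorHom_id]
            exact (sumModification Γ (𝟙 σ)).as.naturality f } }
  associator η σ τ := isoMk (fun b => α_ (η.app b) (σ.app b) (τ.app b)) fun f =>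
    IsSumOf.associator ((precomposing _ _ _).obj (F.map f)) ((postcomposing _ _ _).obj (G.map f))
      (isSumOf_sumNaturality η σ f) (isSumOf_sumNaturality σ τ f)
      (isSumOf_sumNaturality (sumTrans η σ) τ f) (isSumOf_sumNaturality η (sumTrans σ τ) f)
  leftUnitor η := isoMk (fun b => λ_ (η.app b)) fun f =>
    IsSumOf.leftUnitor ((precomposing _ _ _).obj (F.map f)) ((postcomposing _ _ _).obj (G.map f))
      (zeroLeft_zeroNaturality F G f) (isSumOf_sumNaturality (zeroTrans F G) η f)
  rightUnitor η := isoMk (fun b => ρ_ (η.app b)) fun f =>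
    IsSumOf.rightUnitor ((precomposing _ _ _).obj (F.map f)) ((postcomposing _ _ _).obj (G.map f))
      (zeroLeft_zeroNaturality F G f) (isSumOf_sumNaturality η (zeroTrans F G) f)

/-- The pointwise monoidal category of strong transformations. -/
scoped instance transMonoidal (F G : Pseudofunctor B C) : MonoidalCategory (F ⟶ G) where
  __ := transMonoidalStruct F G
  -- Modifications are equal when their components are, and the component of each axiom is
  -- definitionally the axiom in `C`.
  tensorHom_def _ _ := by ext b; exact MonoidalCategory.tensorHom_def _ _
  id_tensorHom_id η σ := by ext b; exact id_tensorHom_id (η.app b) (σ.app b)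
  tensorHom_comp_tensorHom Γ Δ Γ' Δ' := by
    ext b
    exact tensorHom_comp_tensorHom (Γ.as.app b) (Δ.as.app b) (Γ'.as.app b) (Δ'.as.app b)
  whiskerLeft_id η σ := by ext b; exact MonoidalCategory.whiskerLeft_id (η.app b) (σ.app b)
  id_whiskerRight η σ := by ext b; exact MonoidalCategory.id_whiskerRight (η.app b) (σ.app b)
  associator_naturality Γ Δ Λ := by
    ext b
    exact associator_naturality (Γ.as.app b) (Δ.as.app b) (Λ.as.app b)
  leftUnitor_naturality Γ := by ext b; exact leftUnitor_naturality (Γ.as.app b)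
  rightUnitor_naturality Γ := by ext b; exact rightUnitor_naturality (Γ.as.app b)
  pentagon η σ τ υ := by ext b; exact pentagon (η.app b) (σ.app b) (τ.app b) (υ.app b)
  triangle η σ := by ext b; exact triangle (η.app b) (σ.app b)

/-- The pointwise symmetry of the monoidal category of strong transformations. -/
scoped instance transSymmetric (F G : Pseudofunctor B C) : SymmetricCategory (F ⟶ G) where
  braiding η σ := isoMk (fun b => β_ (η.app b) (σ.app b)) fun f =>
    IsSumOf.braiding ((precomposing _ _ _).obj (F.map f)) ((postcomposing _ _ _).obj (G.map f))
      (distribLeft_braiding _ _ _) (distribRight_braiding _ _ _)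
      (isSumOf_sumNaturality η σ f) (isSumOf_sumNaturality σ η f)
  braiding_naturality_right η {_ _} Δ := by
    ext b
    exact BraidedCategory.braiding_naturality_right (η.app b) (Δ.as.app b)
  braiding_naturality_left Γ σ := by
    ext b
    exact BraidedCategory.braiding_naturality_left (Γ.as.app b) (σ.app b)
  hexagon_forward η σ τ := by
    ext b
    exact BraidedCategory.hexagon_forward (η.app b) (σ.app b) (τ.app b)
  hexagon_reverse η σ τ := by
    ext b
    exact BraidedCategory.hexagon_reverse (η.app b) (σ.app b) (τ.app b)
  symmetry η σ := by
    ext b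
    exact SymmetricCategory.symmetry (η.app b) (σ.app b)

end PointwiseSum

/-! ### Composition of strong transformations is additive -/

namespace PointwiseSum

open Pseudofunctor.StrongTrans (isoMk)

variable {B : Type u₁} [Bicategory.{w₁, v₁} B] {C : Type u₂} [Bicategory.{w₂, v₂} C]

section

variable {F G H : Pseudofunctor B C}

theorem comp_naturality_hom (η : F ⟶ G) (θ : G ⟶ H) {b c : B} (f : b ⟶ c) :
    ((η ≫ θ).naturality f).hom = (𝔞 (F.map f) (η.app c) (θ.app c)).inv ≫
      (η.naturality f).hom ▹ θ.app c ≫ (𝔞 (η.app b) (G.map f) (θ.app c)).hom ≫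
      η.app b ◃ (θ.naturality f).hom ≫ (𝔞 (η.app b) (θ.app b) (H.map f)).inv := by
  exact Pseudofunctor.StrongTrans.categoryStruct_comp_naturality_hom ..

end

variable [SMCCategory C] {F G H : Pseudofunctor B C}

/-- The constraint of a composite is a pasting of associators and whiskered constraints, each a sum.
The resulting comparisons have two steps, as `IsSumOf.comp_eq` requires. -/
theorem isSumOf_comp_naturality_left (η : F ⟶ G) (σ τ : G ⟶ H) {b c : B} (f : b ⟶ c) :
    IsSumOf ((distribLeft (F.map f) (η.app c ≫ σ.app c) (η.app c ≫ τ.app c)).hom ≫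
        F.map f ◃ (distribLeft (η.app c) (σ.app c) (τ.app c)).hom)
      ((distribRight (η.app b ≫ σ.app b) (η.app b ≫ τ.app b) (H.map f)).hom ≫
        (distribLeft (η.app b) (σ.app b) (τ.app b)).hom ▹ H.map f)
      ((η ≫ σ).naturality f).hom ((η ≫ τ).naturality f).hom
      ((η ≫ (σ ⊗ τ)).naturality f).hom := by
  simp only [comp_naturality_hom]
  exact (isSumOf_associator_right _ _ _ _).inv.comp
    ((isSumOf_whiskerRight (η.naturality f).hom _ _).comp
    ((isSumOf_associator_right _ _ _ _).comp
    (((isSumOf_sumNaturality σ τ f).whiskerLeft (η.app b)).comp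
    (isSumOf_associator_middle _ _ _ _).inv)))

theorem isSumOf_comp_naturality_right (η σ : F ⟶ G) (τ : G ⟶ H) {b c : B} (f : b ⟶ c) :
    IsSumOf ((distribLeft (F.map f) (η.app c ≫ τ.app c) (σ.app c ≫ τ.app c)).hom ≫
        F.map f ◃ (distribRight (η.app c) (σ.app c) (τ.app c)).hom)
      ((distribRight (η.app b ≫ τ.app b) (σ.app b ≫ τ.app b) (H.map f)).hom ≫
        (distribRight (η.app b) (σ.app b) (τ.app b)).hom ▹ H.map f)
      ((η ≫ τ).naturality f).hom ((σ ≫ τ).naturality f).hom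
      (((η ⊗ σ) ≫ τ).naturality f).hom := by
  simp only [comp_naturality_hom]
  exact (isSumOf_associator_middle _ _ _ _).inv.comp
    (((isSumOf_sumNaturality η σ f).whiskerRight (τ.app c)).comp
    ((isSumOf_associator_left _ _ _ _).comp
    ((isSumOf_whiskerLeft _ _ (τ.naturality f).hom).comp
    (isSumOf_associator_left _ _ _ _).inv)))

/-- Composition of strong transformations distributes over sums on the right. -/
abbrev sumDistribLeft (η : F ⟶ G) (σ τ : G ⟶ H) : (η ≫ σ) ⊗ (η ≫ τ) ≅ η ≫ (σ ⊗ τ) :=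
  isoMk (fun b => distribLeft (η.app b) (σ.app b) (τ.app b)) fun f =>
    (isSumOf_comp_naturality_left η σ τ f).comp_eq (isSumOf_sumNaturality (η ≫ σ) (η ≫ τ) f)

/-- Composition of strong transformations distributes over sums on the left. -/
abbrev sumDistribRight (η σ : F ⟶ G) (τ : G ⟶ H) : (η ≫ τ) ⊗ (σ ≫ τ) ≅ (η ⊗ σ) ≫ τ :=
  isoMk (fun b => distribRight (η.app b) (σ.app b) (τ.app b)) fun f =>
    (isSumOf_comp_naturality_right η σ τ f).comp_eq (isSumOf_sumNaturality (η ≫ τ) (σ ≫ τ) f)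

theorem zeroLeft_comp_naturality (η : F ⟶ G) {b c : B} (f : b ⟶ c) :
    ((zeroLeft (H.obj c) (F.map f)).hom ≫ F.map f ◃ (zeroLeft (H.obj c) (η.app c)).hom) ≫
        ((η ≫ 𝟙_ (G ⟶ H)).naturality f).hom =
      (zeroRight (F.obj b) (H.map f)).hom ≫ (zeroLeft (H.obj b) (η.app b)).hom ▹ H.map f := by
  have z : η.app b ◃ (zeroLeft (H.obj c) (G.map f)).hom ≫ η.app b ◃ zeroNaturality G H f =
      η.app b ◃ (zeroRight _ (H.map f)).hom := by
    rw [← Bicategory.whiskerLeft_comp, zeroLeft_zeroNaturality]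
  -- The goal with the composite constraint expanded and the constraint of zero displayed as
  -- `zeroNaturality`, so that the lemmas on zero can rewrite it.
  have e : ((zeroLeft (H.obj c) (F.map f)).hom ≫ F.map f ◃ (zeroLeft (H.obj c) (η.app c)).hom) ≫
      (𝔞 (F.map f) (η.app c) (𝟙_ _)).inv ≫
      (η.naturality f).hom ▹ 𝟙_ _ ≫ (𝔞 (η.app b) (G.map f) (𝟙_ _)).hom ≫
      η.app b ◃ zeroNaturality G H f ≫ (𝔞 (η.app b) (𝟙_ _) (H.map f)).inv =
      (zeroRight (F.obj b) (H.map f)).hom ≫ (zeroLeft (H.obj b) (η.app b)).hom ▹ H.map f := by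
    rw [(Iso.eq_comp_inv _).2 (zeroRight_associator_middle (η.app b) (c := H.obj b) (H.map f)),
      ← zeroLeft_associator_right]
    simp only [Category.assoc, Iso.hom_inv_id_assoc]
    rw [reassoc_of% zeroLeft_naturality, reassoc_of% zeroLeft_associator_right, reassoc_of% z]
  exact (congrArg _ (comp_naturality_hom ..)).trans e

theorem zeroRight_comp_naturality (τ : G ⟶ H) {b c : B} (f : b ⟶ c) :
    ((zeroLeft (H.obj c) (F.map f)).hom ≫ F.map f ◃ (zeroRight (F.obj c) (τ.app c)).hom) ≫
        ((𝟙_ (F ⟶ G) ≫ τ).naturality f).hom =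
      (zeroRight (F.obj b) (H.map f)).hom ≫ (zeroRight (F.obj b) (τ.app b)).hom ▹ H.map f := by
  have z : (zeroLeft (G.obj c) (F.map f)).hom ▹ τ.app c ≫ zeroNaturality F G f ▹ τ.app c =
      (zeroRight _ (G.map f)).hom ▹ τ.app c := by
    rw [← Bicategory.comp_whiskerRight, zeroLeft_zeroNaturality]
  have l := zeroRight_associator_left (F.obj b) (G.map f) (τ.app c)
  rw [Category.assoc] at l
  have e : ((zeroLeft (H.obj c) (F.map f)).hom ≫ F.map f ◃ (zeroRight (F.obj c) (τ.app c)).hom) ≫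
      (𝔞 (F.map f) (𝟙_ _) (τ.app c)).inv ≫
      zeroNaturality F G f ▹ τ.app c ≫ (𝔞 (𝟙_ _) (G.map f) (τ.app c)).hom ≫
      𝟙_ _ ◃ (τ.naturality f).hom ≫ (𝔞 (𝟙_ _) (τ.app b) (H.map f)).inv =
      (zeroRight (F.obj b) (H.map f)).hom ≫ (zeroRight (F.obj b) (τ.app b)).hom ▹ H.map f := by
    rw [← zeroRight_associator_middle]
    simp only [Category.assoc, Iso.hom_inv_id_assoc]
    rw [reassoc_of% z, reassoc_of% l, reassoc_of% zeroRight_naturality, Iso.comp_inv_eq,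
      ← zeroRight_associator_left]
  exact (congrArg _ (comp_naturality_hom ..)).trans e

/-- The nullary analogue of `IsSumOf.comp_eq`. -/
theorem comp_eq_comp_of_epi {D : Type*} [Category* D] {o P P' Q Q' : D} {m : o ⟶ P} [Epi m]
    {g : P ⟶ P'} {X : P' ⟶ Q'} {n : o ⟶ Q} {h : Q ⟶ Q'} {S : P ⟶ Q}
    (hX : (m ≫ g) ≫ X = n ≫ h) (hS : m ≫ S = n) : g ≫ X = S ≫ h := by
  rw [← cancel_epi m, ← Category.assoc, hX, reassoc_of% hS]

/-- Composition of strong transformations preserves zero on the right. -/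
abbrev zeroTransLeft (η : F ⟶ G) (H : Pseudofunctor B C) : 𝟙_ (F ⟶ H) ≅ η ≫ 𝟙_ (G ⟶ H) :=
  isoMk (fun b => zeroLeft (H.obj b) (η.app b)) fun f =>
    comp_eq_comp_of_epi (zeroLeft_comp_naturality η f) (zeroLeft_zeroNaturality F H f)

/-- Composition of strong transformations preserves zero on the left. -/
abbrev zeroTransRight (F : Pseudofunctor B C) (τ : G ⟶ H) : 𝟙_ (F ⟶ H) ≅ 𝟙_ (F ⟶ G) ≫ τ :=
  isoMk (fun b => zeroRight (F.obj b) (τ.app b)) fun f =>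
    comp_eq_comp_of_epi (zeroRight_comp_naturality τ f) (zeroLeft_zeroNaturality F H f)

/-- Pointwise, `σ ↦ - ≫ σ` is a strong monoidal functor. -/
@[reducible]
def postcomposingMonoidal (F G H : Pseudofunctor B C) : (postcomposing F G H).Monoidal :=
  Functor.CoreMonoidal.toMonoidal
    { εIso := NatIso.ofComponents (fun η => zeroTransLeft η H) fun Γ => by
        ext b
        exact (ε (postcomposing _ _ _)).naturality (Γ.as.app b)
      μIso σ τ := NatIso.ofComponents (fun η => sumDistribLeft η σ τ) fun Γ => by
        ext b
        exact (μ (postcomposing _ _ _) (σ.app b) (τ.app b)).naturality (Γ.as.app b)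
      μIso_hom_natural_left Γ σ := by
        ext η b
        exact congr_app (μ_natural_left (postcomposing _ _ _) (Γ.as.app b) (σ.app b)) (η.app b)
      μIso_hom_natural_right σ Γ := by
        ext η b
        exact congr_app (μ_natural_right (postcomposing _ _ _) (σ.app b) (Γ.as.app b)) (η.app b)
      associativity σ τ υ := by
        ext η b
        exact congr_app (associativity (postcomposing _ _ _) (σ.app b) (τ.app b) (υ.app b))
          (η.app b)
      left_unitality σ := by
        ext η b
        exact congr_app (left_unitality (postcomposing _ _ _) (σ.app b)) (η.app b)
      right_unitality σ := by
        ext η b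
        exact congr_app (right_unitality (postcomposing _ _ _) (σ.app b)) (η.app b) }

/-- Pointwise, `η ↦ η ≫ -` is a strong monoidal functor. -/
@[reducible]
def precomposingMonoidal (F G H : Pseudofunctor B C) : (precomposing F G H).Monoidal :=
  Functor.CoreMonoidal.toMonoidal
    { εIso := NatIso.ofComponents (fun τ => zeroTransRight F τ) fun Γ => by
        ext b
        exact (ε (precomposing _ _ _)).naturality (Γ.as.app b)
      μIso η σ := NatIso.ofComponents (fun τ => sumDistribRight η σ τ) fun Γ => by
        ext b
        exact (μ (precomposing _ _ _) (η.app b) (σ.app b)).naturality (Γ.as.app b)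
      μIso_hom_natural_left Γ σ := by
        ext η b
        exact congr_app (μ_natural_left (precomposing _ _ _) (Γ.as.app b) (σ.app b)) (η.app b)
      μIso_hom_natural_right σ Γ := by
        ext η b
        exact congr_app (μ_natural_right (precomposing _ _ _) (σ.app b) (Γ.as.app b)) (η.app b)
      associativity σ τ υ := by
        ext η b
        exact congr_app (associativity (precomposing _ _ _) (σ.app b) (τ.app b) (υ.app b))
          (η.app b)
      left_unitality σ := by
        ext η b
        exact congr_app (left_unitality (precomposing _ _ _) (σ.app b)) (η.app b)
      right_unitality σ := by
        ext η b
        exact congr_app (right_unitality (precomposing _ _ _) (σ.app b)) (η.app b) }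

/-- The pointwise data of an SMC-category on pseudofunctors. -/
@[reducible]
def smcData : SMCData (Pseudofunctor B C) where
  homMonoidal F G := transMonoidal F G
  homSymmetric F G := transSymmetric F G
  postcomposingBraided F G H :=
    { toMonoidal := postcomposingMonoidal F G H
      braided σ τ := by
        ext η b
        exact congr_app (Functor.LaxBraided.braided (F := postcomposing _ _ _) (σ.app b) (τ.app b))
          (η.app b) }
  precomposingBraided F G H :=
    { toMonoidal := precomposingMonoidal F G H
      braided η σ := by
        ext τ b
        exact congr_app (Functor.LaxBraided.braided (F := precomposing _ _ _) (η.app b) (σ.app b))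
          (τ.app b) }

end PointwiseSum

/-! ### The SMC-category of pseudofunctors -/

namespace PointwiseSum

variable {B : Type u₁} [Bicategory.{w₁, v₁} B] {C : Type u₂} [Bicategory.{w₂, v₂} C]
  [SMCCategory C]

/-- The pointwise SMC-category of pseudofunctors. -/
@[reducible]
def smcCategory : SMCCategory (Pseudofunctor B C) where
  __ := smcData
  -- The conditions on `μ` and `ε` are needed only here, to be inherited pointwise; condition 2 was
  -- already needed to form sums and zeros.
  postcomposing_μ_isMonoidal σ τ :=
    { unit := by
        ext b
        exact (SMCCategory.postcomposing_μ_isMonoidal (σ.app b) (τ.app b)).unit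
      tensor η θ := by
        ext b
        exact (SMCCategory.postcomposing_μ_isMonoidal (σ.app b) (τ.app b)).tensor
          (η.app b) (θ.app b) }
  precomposing_μ_isMonoidal σ τ :=
    { unit := by
        ext b
        exact (SMCCategory.precomposing_μ_isMonoidal (σ.app b) (τ.app b)).unit
      tensor η θ := by
        ext b
        exact (SMCCategory.precomposing_μ_isMonoidal (σ.app b) (τ.app b)).tensor
          (η.app b) (θ.app b) }
  postcomposing_ε_isMonoidal F G H :=
    { unit := by
        ext b
        exact (SMCCategory.postcomposing_ε_isMonoidal (F.obj b) (G.obj b) (H.obj b)).unit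
      tensor η θ := by
        ext b
        exact (SMCCategory.postcomposing_ε_isMonoidal (F.obj b) (G.obj b) (H.obj b)).tensor
          (η.app b) (θ.app b) }
  precomposing_ε_isMonoidal F G H :=
    { unit := by
        ext b
        exact (SMCCategory.precomposing_ε_isMonoidal (F.obj b) (G.obj b) (H.obj b)).unit
      tensor η θ := by
        ext b
        exact (SMCCategory.precomposing_ε_isMonoidal (F.obj b) (G.obj b) (H.obj b)).tensor
          (η.app b) (θ.app b) }
  associatorLeft_isMonoidal F _ _ _ σ τ :=
    { unit := by
        ext b
        exact (SMCCategory.associatorLeft_isMonoidal (F.obj b) (σ.app b) (τ.app b)).unit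
      tensor η θ := by
        ext b
        exact (SMCCategory.associatorLeft_isMonoidal (F.obj b) (σ.app b) (τ.app b)).tensor
          (η.app b) (θ.app b) }
  associatorMiddle_isMonoidal σ τ :=
    { unit := by
        ext b
        exact (SMCCategory.associatorMiddle_isMonoidal (σ.app b) (τ.app b)).unit
      tensor η θ := by
        ext b
        exact (SMCCategory.associatorMiddle_isMonoidal (σ.app b) (τ.app b)).tensor
          (η.app b) (θ.app b) }
  associatorRight_isMonoidal σ τ K :=
    { unit := by
        ext b
        exact (SMCCategory.associatorRight_isMonoidal (σ.app b) (τ.app b) (K.obj b)).unit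
      tensor η θ := by
        ext b
        exact (SMCCategory.associatorRight_isMonoidal (σ.app b) (τ.app b) (K.obj b)).tensor
          (η.app b) (θ.app b) }
  leftUnitor_isMonoidal F G :=
    { unit := by
        ext b
        exact (SMCCategory.leftUnitor_isMonoidal (F.obj b) (G.obj b)).unit
      tensor η θ := by
        ext b
        exact (SMCCategory.leftUnitor_isMonoidal (F.obj b) (G.obj b)).tensor
          (η.app b) (θ.app b) }
  rightUnitor_isMonoidal F G :=
    { unit := by
        ext b
        exact (SMCCategory.rightUnitor_isMonoidal (F.obj b) (G.obj b)).unit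
      tensor η θ := by
        ext b
        exact (SMCCategory.rightUnitor_isMonoidal (F.obj b) (G.obj b)).tensor
          (η.app b) (θ.app b) }

theorem isPointwiseSMC :
    letI : SMCCategory (Pseudofunctor B C) := smcCategory
    IsPointwiseSMC B C :=
  letI : SMCCategory (Pseudofunctor B C) := smcCategory
  { sum_app _ _ _ := rfl
    sum_naturality _ _ _ _ _ := HEq.rfl
    zero_app _ _ _ := rfl
    zero_naturality _ _ _ _ _ := HEq.rfl
    sum_modification _ _ _ := HEq.rfl
    associator_app _ _ _ _ := HEq.rfl
    leftUnitor_app _ _ := HEq.rfl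
    rightUnitor_app _ _ := HEq.rfl
    braiding_app _ _ _ := HEq.rfl
    postcomposing_μ_app _ _ _ _ := HEq.rfl
    postcomposing_ε_app _ _ _ := HEq.rfl
    precomposing_μ_app _ _ _ _ := HEq.rfl
    precomposing_ε_app _ _ _ _ _ := HEq.rfl }

end PointwiseSum

/-! ### Strictness -/

/-- Naturality makes `P` and `Q` agree on morphisms up to conjugation by `eqToHom`, which is what
functor extensionality asks for. The existential delivers the equality together with the
identification that depends on it. -/
theorem exists_eq_eqToHom_of_app {D : Type u₁} [Category.{v₁} D] {E : Type u₂} [Category.{v₂} E]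
    {P Q : D ⥤ E} (t : P ⟶ Q) (h : ∀ x, ∃ e : P.obj x = Q.obj x, t.app x = eqToHom e) :
    ∃ e : P = Q, t = eqToHom e := by
  choose e he using h
  obtain rfl : P = Q := CategoryTheory.Functor.ext e fun x y f => by
    have n := t.naturality f
    rw [he, he] at n
    rw [← reassoc_of% n, eqToHom_trans, eqToHom_refl, Category.comp_id]
  exact ⟨rfl, by ext x; exact he x⟩

theorem exists_eq_eqToHom_of_as_app {B : Type u₁} [Bicategory.{w₁, v₁} B] {C : Type u₂}
    [Bicategory.{w₂, v₂} C] {F G : Pseudofunctor B C} {η θ : F ⟶ G} (Γ : η ⟶ θ)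
    (h : ∀ b, ∃ e : η.app b = θ.app b, Γ.as.app b = eqToHom e) :
    ∃ e : η = θ, Γ = eqToHom e := by
  choose e he using h
  -- Once the components of `η` and `θ` are identified, the `eqToHom`s in these squares become
  -- identities, and the squares say that the naturality constraints agree. The other fields are
  -- propositions.
  have n := fun (b c : B) (f : b ⟶ c) => Γ.as.naturality f
  simp only [he] at n
  obtain rfl : η = θ := by
    obtain ⟨p, ν, _, _, _⟩ := η
    obtain ⟨q, ν', _, _, _⟩ := θ
    obtain rfl : p = q := funext e
    congr 1
    funext b c f
    ext
    simpa using (n b c f).symm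
  exact ⟨rfl, by ext b; exact he b⟩

theorem exists_eq_eqToHom_iff {D : Type u₁} [Category.{v₁} D] {x y : D} (e : x ≅ y) :
    (∃ h : x = y, e = eqToIso h) ↔ ∃ h : x = y, e.hom = eqToHom h := by
  simp only [Iso.ext_iff, eqToIso.hom]

namespace PointwiseSum

variable {B : Type u₁} [Bicategory.{w₁, v₁} B] {C : Type u₂} [Bicategory.{w₂, v₂} C]

theorem exists_eq_eqToIso {F G : Pseudofunctor B C} {η θ : F ⟶ G} (Γ : η ≅ θ)
    (h : ∀ b, ∃ e : η.app b = θ.app b, Γ.hom.as.app b = eqToHom e) :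
    ∃ e : η = θ, Γ = eqToIso e :=
  (exists_eq_eqToHom_iff Γ).2 (exists_eq_eqToHom_of_as_app Γ.hom h)

theorem strict [Bicategory.Strict C] : Bicategory.Strict (Pseudofunctor B C) := by
  have l {F G : Pseudofunctor B C} (η : F ⟶ G) := exists_eq_eqToIso (𝔩 η) fun b =>
    ⟨Bicategory.Strict.id_comp (η.app b),
     congrArg Iso.hom (Bicategory.Strict.leftUnitor_eqToIso (η.app b))⟩
  have r {F G : Pseudofunctor B C} (η : F ⟶ G) := exists_eq_eqToIso (𝔯 η) fun b =>
    ⟨Bicategory.Strict.comp_id (η.app b),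
     congrArg Iso.hom (Bicategory.Strict.rightUnitor_eqToIso (η.app b))⟩
  have a {F G H K : Pseudofunctor B C} (η : F ⟶ G) (θ : G ⟶ H) (ι : H ⟶ K) :=
    exists_eq_eqToIso (𝔞 η θ ι) fun b =>
      ⟨Bicategory.Strict.assoc (η.app b) (θ.app b) (ι.app b),
       congrArg Iso.hom (Bicategory.Strict.associator_eqToIso (η.app b) (θ.app b) (ι.app b))⟩
  exact
    { id_comp η := (l η).1
      comp_id η := (r η).1
      assoc η θ ι := (a η θ ι).1
      leftUnitor_eqToIso η := (l η).2
      rightUnitor_eqToIso η := (r η).2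
      associator_eqToIso η θ ι := (a η θ ι).2 }

variable [SMCCategory C]

theorem isStrictMonoidalCategory [IsPCCategory C] (F G : Pseudofunctor B C) :
    IsStrictMonoidalCategory (F ⟶ G) := by
  have s (b : B) := IsPCCategory.hom_strict (F.obj b) (G.obj b)
  have l (η : F ⟶ G) := exists_eq_eqToIso (λ_ η) fun b =>
    ⟨(s b).unit_tensor (η.app b),
     congrArg Iso.hom ((s b).leftUnitor_eqToIso (η.app b))⟩
  have r (η : F ⟶ G) := exists_eq_eqToIso (ρ_ η) fun b =>
    ⟨(s b).tensor_unit (η.app b),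
     congrArg Iso.hom ((s b).rightUnitor_eqToIso (η.app b))⟩
  have a (η θ ι : F ⟶ G) := exists_eq_eqToIso (α_ η θ ι) fun b =>
    ⟨(s b).tensor_assoc (η.app b) (θ.app b) (ι.app b),
     congrArg Iso.hom ((s b).associator_eqToIso (η.app b) (θ.app b) (ι.app b))⟩
  exact
    { tensor_assoc η θ ι := (a η θ ι).1
      unit_tensor η := (l η).1
      tensor_unit η := (r η).1
      associator_eqToIso η θ ι := (a η θ ι).2
      leftUnitor_eqToIso η := (l η).2
      rightUnitor_eqToIso η := (r η).2 }

/-- Turns strictness in `C`, an equation of natural transformations, into the componentwise form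
that `exists_eq_eqToHom_of_as_app` takes as input. -/
theorem exists_app_eq_eqToHom {D : Type*} [Category* D] {E : Type*} [Category* E]
    {P Q : D ⥤ E} {t : P ⟶ Q} {h : P = Q} (ht : t = eqToHom h) (x : D) :
    ∃ e : P.obj x = Q.obj x, t.app x = eqToHom e :=
  ⟨_, (congr_app ht x).trans (eqToHom_app h x)⟩

theorem isPCCategory [IsPCCategory C] :
    letI : SMCCategory (Pseudofunctor B C) := smcCategory
    IsPCCategory (Pseudofunctor B C) := by
  let _ : SMCCategory (Pseudofunctor B C) := smcCategory
  -- Strictness is reduced twice: from natural transformations to their components, which are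
  -- modifications, and from these to 2-cells of `C`.
  have post {F G H : Pseudofunctor B C} (σ τ : G ⟶ H) :=
    exists_eq_eqToHom_of_app (μ (postcomposing F G H) σ τ) fun η =>
      exists_eq_eqToHom_of_as_app _ fun b => exists_app_eq_eqToHom
        ((IsPCCategory.postcomposing_strict _ _ _).μ_eqToHom (σ.app b) (τ.app b)) (η.app b)
  have post₀ (F G H : Pseudofunctor B C) :=
    exists_eq_eqToHom_of_app (ε (postcomposing F G H)) fun η =>
      exists_eq_eqToHom_of_as_app _ fun b => exists_app_eq_eqToHom
        ((IsPCCategory.postcomposing_strict _ _ (H.obj b)).ε_eqToHom) (η.app b)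
  have pre₀ (F G H : Pseudofunctor B C) :=
    exists_eq_eqToHom_of_app (ε (precomposing F G H)) fun τ =>
      exists_eq_eqToHom_of_as_app _ fun b => exists_app_eq_eqToHom
        ((IsPCCategory.precomposing_unital (F.obj b) _ _).ε_eqToHom) (τ.app b)
  have := IsPCCategory.strict (C := C)
  exact
    { strict := strict
      hom_strict := isStrictMonoidalCategory
      postcomposing_strict F G H :=
        { unit_eq := (post₀ F G H).1
          ε_eqToHom := (post₀ F G H).2
          tensor_eq σ τ := (post σ τ).1
          μ_eqToHom σ τ := (post σ τ).2 }
      precomposing_unital F G H :=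
        { unit_eq := (pre₀ F G H).1
          ε_eqToHom := (pre₀ F G H).2 } }

end PointwiseSum

theorem proposition7p1 (B : Type u₁) [Bicategory.{w₁, v₁} B] (C : Type u₂) [Bicategory.{w₂, v₂} C]
    [SMCCategory C] :
    ∃ _ : SMCCategory (Pseudofunctor B C),
      IsPointwiseSMC B C ∧ (IsPCCategory C → IsPCCategory (Pseudofunctor B C)) :=
  ⟨PointwiseSum.smcCategory, PointwiseSum.isPointwiseSMC, fun _ => PointwiseSum.isPCCategory⟩
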